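/- **Setting.** Let $s\ge 0$ be an integer, $N_k,K_k\ge 0$ $(k\ge 0)$ with $N_0=K_0=0$, $M_l=\sum_{k=0}^{l}(N_k+K_k)$, $S=\bigcup_{l=1}^{s}[-M_l-N_l,-M_l]$, $S^+=\bigcup_{l=1}^{s}[M_l,M_l+N_l]$, $R^s=[0,\infty)\setminus S^+$, $T=S\cup[0,\infty)$, $\mathbb R^-=(-\infty,0)$. Let $a:\mathbb R\to\mathbb C$ satisfy $\int_{R^s}|a(t)|\,dt<\infty$ and $\int_{R^s}t|a(t)|^2dt<\infty$, and put $A(\omega)=\int_{R^s}a(t)e^{-it\omega}dt$. The functional $A\xi=\int_{R^s}a(t)\xi(-t)\,dt$ of a stationary process $\xi$ with spectral density $f$ is estimated from observations of $\xi(t)+\eta(t)$, $t\in\mathbb R^-\setminus S$, where $\eta$ is a stationary process with spectral density $g$, uncorrelated with $\xi$. A spectral density is a nonnegative integrable function on $\mathbb R$. $L_2^s(w)$ is the closed linear span of $\{e^{it\omega}:t\in\mathbb R^-\setminus S\}$ in $L_2(w)$. The estimate with spectral characteristic $h\in L_2^s(f+g)$ has mean-square error $$\Delta(h;f,g)=\frac1{2\pi}\int|A-h|^2f\,d\omega+\frac1{2\pi}\int|h|^2g\,d\omega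 ,$$ and $h(f,g)$ denotes the minimizer of $\Delta(\cdot\,;f,g)$ over $L_2^s(f+g)$. For a class $D$ of pairs of densities, $(f_0,g_0)\in D$ is *least favorable* if $\Delta(h(f_0,g_0);f_0,g_0)=\max_{(f,g)\in D}\Delta(h(f,g);f,g)$. A characteristic $h^0\in H_D=\bigcap_{(f,g)\in D}L_2^s(f+g)$ is *minimax-robust* if $\max_{(f,g)\in D}\Delta(h^0;f,g)$ is attained and equals $\min_{h\in H_D}\sup_{(f,g)\in D}\Delta(h;f,g)$. **Operators.** For $f,g$ let $B$ and $R$ be the operators over $T$ with symbols $1/(f+g)$ and $f/(f+g)$, that is $(Bc)(t)=\frac1{2\pi}\int C(\omega)e^{-it\omega}\frac{d\omega}{f+g}$ and $(Ra)(t)=\frac1{2\pi}\int A(\omega)e^{-it\omega}\frac{f}{f+g}\,d\omega$ for $t\in T$, and put $\langle Qa,a\rangle=\frac1{2\pi}\int|A|^2\frac{fg}{f+g}\,d\omega$. They are understood through their forms: the form domain of $B$ consists of the spectra $C$ with $\int|C|^2/(f+g)\,d\omega<\infty$ whose transform $c(t)=\frac1{2\pi}\int C(\omega)e^{-it\omega}d\omega$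 vanishes off $T$, so that $C(\omega)=\int_Tc(t)e^{it\omega}dt$ in the sense of Fourier transforms. $C$ is the spectrum of $c=B^{-1}Ra$ if it lies in this domain and $\langle Bc,k\rangle=\langle Ra,k\rangle$, i.e. $\int\frac{C\overline K}{f+g}\,d\omega=\int A\frac{f}{f+g}\overline K\,d\omega$, for every $K$ in this domain. Let $C^0$ be the spectrum of $B^{-1}Ra$ for the pair $(f_0,g)$. The problem (extrem) for $(f_0,g)$ and the class $D$ is $$\max_{(f',g')\in D}\big(\langle Ra,B^{-1}Ra\rangle+\langle Qa,a\rangle\big)=\langle R^0a,(B^0)^{-1}R^0a\rangle+\langle Q^0a,a\rangle ,$$ with the operators on the left formed from $(f',g')$ and those on the right from $(f_0,g)$. **Statement.** Let $g$ be a known spectral density, $f_1$ a fixed spectral density, and let $f_0\in D^2_{\varepsilon_1}$, the class of all spectral densities $f$ with $\frac1{2\pi}\int|f-f_1|^2d\omega\le\varepsilon_1$; put $D=D^2_{\varepsilon_1}\times\{g\}$. Assume: 1. $f_0+g$ satisfies the minimality condition $\int|\gamma|^2/(f_0+g)\,d\omega<\infty$ for some nontrivial function of exponential type $\gamma(\omega)=\int_0^\infty\alpha(t)e^{it\omega}dt$;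 2. $h_f(f_0,g)=|Ag+C^0|^2/(f_0+g)^2$ is (essentially) bounded; 3. $|Ag+C^0|^2=(f_0+g)^2(f_0-f_1)\,\alpha_1$ almost everywhere, for a constant $\alpha_1$; 4. $(f_0,g)$ solves (extrem) for $D$. Then $f_0$ is least favorable: $(f_0,g)$ is least favorable in $D$. The function $$h^0=A\frac{f_0}{f_0+g}-\frac{C^0}{f_0+g}$$ is the spectral characteristic $h(f_0,g)$ of the optimal linear estimate; it is minimax-robust for $D$, and every minimax-robust spectral characteristic for $D$ coincides with it almost everywhere. -/

import Mathlib

open MeasureTheory Set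
open scoped ENNReal ComplexConjugate

/-- A spectral density: a nonnegative Lebesgue integrable function on the real line. -/
structure IsSpectralDensity (f : ℝ → ℝ) : Prop where
  nonneg : ∀ ω, 0 ≤ f ω
  integrable : Integrable f

/-- The minimality condition `∫ |γ|² / w < ∞` for some nontrivial function of exponential type
`γ(ω) = ∫_0^∞ α(t) e^{itω} dt`. (In `ℝ≥0∞`, `0 / 0 = 0` and `x / 0 = ∞` for `x ≠ 0`.) -/
def MinimalityCondition (w : ℝ → ℝ) : Prop :=
  ∃ (α : ℝ → ℂ) (γ : ℂ → ℂ), IntegrableOn α (Ici 0) ∧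
    (∀ ω : ℝ, γ ω = ∫ t in Ici (0 : ℝ), α t * Complex.exp (Complex.I * t * ω)) ∧
    Differentiable ℂ γ ∧
    (∃ k c : ℝ, ∀ z, ‖γ z‖ ≤ k * Real.exp (c * ‖z‖)) ∧
    (∃ z, γ z ≠ 0) ∧
    ∫⁻ ω : ℝ, ‖γ ω‖ₑ ^ 2 / ENNReal.ofReal (w ω) < ⊤

/-- The class of spectral densities `f` with `(1/2π) ∫ |f - f₁|² ≤ ε`. -/
def l2Ball (f₁ : ℝ → ℝ) (ε : ℝ) : Set (ℝ → ℝ) :=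
  {f | IsSpectralDensity f ∧ Integrable (fun ω => |f ω - f₁ ω| ^ 2) ∧
    (1 / (2 * Real.pi)) * ∫ ω, |f ω - f₁ ω| ^ 2 ≤ ε}

/-- The measure with density `w / 2π` on the real line. -/
noncomputable def spectralMeasure (w : ℝ → ℝ) : Measure ℝ :=
  volume.withDensity fun ω => ENNReal.ofReal (w ω / (2 * Real.pi))

/-- The data of the filtering problem: the number `s` of gaps, their lengths `N 1, …, N s`, the
lengths `K 1, …, K s` that separate them, and the weight function `a` of the functional
`Aξ = ∫_{R^s} a(t) ξ(-t) dt`. -/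
structure FilteringProblem where
  s : ℕ
  N : ℕ → ℝ
  K : ℕ → ℝ
  a : ℝ → ℂ

namespace FilteringProblem

variable (P : FilteringProblem)

/-- `M_l = ∑_{k=0}^l (N_k + K_k)`. -/
noncomputable def M (l : ℕ) : ℝ := ∑ k ∈ Finset.range (l + 1), (P.N k + P.K k)

/-- `S = ⋃_{l=1}^s [-M_l - N_l, -M_l]`, the times of the missing observations. -/
def S : Set ℝ := ⋃ l ∈ Finset.Icc 1 P.s, Icc (-P.M l - P.N l) (-P.M l)

/-- `S⁺ = ⋃_{l=1}^s [M_l, M_l + N_l]`. -/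
def Splus : Set ℝ := ⋃ l ∈ Finset.Icc 1 P.s, Icc (P.M l) (P.M l + P.N l)

/-- `R^s = [0, ∞) \ S⁺`. -/
def Rs : Set ℝ := Ici 0 \ P.Splus

/-- `ℝ⁻ \ S`, the times at which `ξ + η` is observed. -/
def observed : Set ℝ := Iio 0 \ P.S

/-- `T = S ∪ [0, ∞)`. It is the complement of `observed`. -/
def T : Set ℝ := P.S ∪ Ici 0

/-- The standing assumptions on the gaps and on the weight function. -/
structure IsAdmissible : Prop where
  N_zero : P.N 0 = 0
  K_zero : P.K 0 = 0
  N_nonneg : ∀ k, 0 ≤ P.N k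
  K_nonneg : ∀ k, 0 ≤ P.K k
  integrable_a : IntegrableOn P.a P.Rs
  integrable_sq : IntegrableOn (fun t => t * ‖P.a t‖ ^ 2) P.Rs

/-- `A(e^{iω}) = ∫_{R^s} a(t) e^{-itω} dt`. -/
noncomputable def A (ω : ℝ) : ℂ := ∫ t in P.Rs, P.a t * Complex.exp (-(Complex.I * t * ω))

/-- `L_2^s(w)`: the functions in the closed linear span, in `L_2(w)`, of the exponentials
`ω ↦ e^{itω}`, `t ∈ ℝ⁻ \ S`. -/
def L2s (w : ℝ → ℝ) : Set (ℝ → ℂ) :=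
  {h | MemLp h 2 (spectralMeasure w) ∧ ∀ ε : ℝ≥0∞, 0 < ε →
    ∃ p ∈ Submodule.span ℂ
      ((fun (t ω : ℝ) => Complex.exp (Complex.I * t * ω)) '' P.observed),
      eLpNorm (h - p) 2 (spectralMeasure w) < ε}

/-- The mean-square error
`Δ(h; f, g) = (1/2π) ∫ |A - h|² f dω + (1/2π) ∫ |h|² g dω`
of the linear estimate with spectral characteristic `h`. -/
noncomputable def Δ (h : ℝ → ℂ) (f g : ℝ → ℝ) : ℝ≥0∞ :=
  (∫⁻ ω, ‖P.A ω - h ω‖ₑ ^ 2 ∂spectralMeasure f) + ∫⁻ ω, ‖h ω‖ₑ ^ 2 ∂spectralMeasure g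

/-- `h` is the spectral characteristic `h(f, g)` of the mean-square optimal linear estimate. -/
def IsOptimal (f g : ℝ → ℝ) (h : ℝ → ℂ) : Prop :=
  h ∈ P.L2s (f + g) ∧ ∀ h' ∈ P.L2s (f + g), P.Δ h f g ≤ P.Δ h' f g

/-- `(f₀, g₀)` is least favorable in the class `D`:
`Δ(h(f₀, g₀); f₀, g₀) = max_{(f, g) ∈ D} Δ(h(f, g); f, g)`. -/
def IsLeastFavorable (D : Set ((ℝ → ℝ) × (ℝ → ℝ))) (f₀ g₀ : ℝ → ℝ) : Prop :=
  (f₀, g₀) ∈ D ∧ ∃ h₀, P.IsOptimal f₀ g₀ h₀ ∧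
    ∀ p ∈ D, ∀ h, P.IsOptimal p.1 p.2 h → P.Δ h p.1 p.2 ≤ P.Δ h₀ f₀ g₀

/-- `H_D = ⋂_{(f, g) ∈ D} L_2^s(f + g)`. -/
def HD (D : Set ((ℝ → ℝ) × (ℝ → ℝ))) : Set (ℝ → ℂ) := ⋂ p ∈ D, P.L2s (p.1 + p.2)

/-- `h₀ ∈ H_D` is minimax-robust for the class `D`: the maximum of `Δ(h₀; f, g)` over `D` is
attained, and it is the least value of the supremum of `Δ(h; f, g)` over `D` for `h ∈ H_D`. -/
def IsMinimaxRobust (D : Set ((ℝ → ℝ) × (ℝ → ℝ))) (h₀ : ℝ → ℂ) : Prop :=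
  h₀ ∈ P.HD D ∧ (∃ p ∈ D, ∀ q ∈ D, P.Δ h₀ q.1 q.2 ≤ P.Δ h₀ p.1 p.2) ∧
    ∀ h ∈ P.HD D, ⨆ p ∈ D, P.Δ h₀ p.1 p.2 ≤ ⨆ p ∈ D, P.Δ h p.1 p.2

/-- The function of time `c(t) = (1/2π) ∫ C(ω) e^{-itω} dω` with spectrum `C`, so that
`C(ω) = ∫ c(t) e^{itω} dt`. -/
noncomputable def signal (C : ℝ → ℂ) (t : ℝ) : ℂ :=
  (1 / (2 * Real.pi)) * ∫ ω : ℝ, C ω * Complex.exp (-(Complex.I * t * ω))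

/-- The form domain of the operator `B` of the pair of densities `f, g`. A function `c` that lives
on `T` is represented by its spectrum `C(ω) = ∫_T c(t) e^{itω} dt`; it lies in the domain if
`⟨Bc, c⟩ = (1/2π) ∫ |C|² / (f + g) dω` is finite. As `f + g` is integrable, such a `C` is
integrable, so `c = signal C` is a continuous function, and it has to vanish off `T`. -/
structure InFormDomain (f g : ℝ → ℝ) (C : ℝ → ℂ) : Prop where
  aestronglyMeasurable : AEStronglyMeasurable C volume
  finite_energy : ∫⁻ ω, ‖C ω‖ₑ ^ 2 / ENNReal.ofReal (f ω + g ω) < ⊤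
  supported : ∀ t ∉ P.T, signal C t = 0

/-- `⟨Bc, k⟩` for `c, k` on `T` with spectra `C, K`, where
`(Bc)(t) = (1/2π) ∫_T c(u) ∫ e^{iω(u-t)} (f + g)⁻¹ dω du`. -/
noncomputable def formB (f g : ℝ → ℝ) (C K : ℝ → ℂ) : ℂ :=
  (1 / (2 * Real.pi)) * ∫ ω, C ω * (1 / (f ω + g ω) : ℝ) * conj (K ω)

/-- `⟨Ra, k⟩` for `k` on `T` with spectrum `K`, where
`(Ra)(t) = (1/2π) ∫_{R^s} a(u) ∫ e^{-iω(u+t)} f (f + g)⁻¹ dω du`. -/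
noncomputable def formR (f g : ℝ → ℝ) (K : ℝ → ℂ) : ℂ :=
  (1 / (2 * Real.pi)) * ∫ ω, P.A ω * (f ω / (f ω + g ω) : ℝ) * conj (K ω)

/-- `⟨Qa, a⟩`, where `Q` has the symbol `f g (f + g)⁻¹`. -/
noncomputable def formQ (f g : ℝ → ℝ) : ℂ :=
  (1 / (2 * Real.pi)) * ∫ ω, P.A ω * (f ω * g ω / (f ω + g ω) : ℝ) * conj (P.A ω)

/-- `C` is the spectrum of `c = B⁻¹Ra`: it belongs to the form domain of `B`, and `Bc = Ra`. -/
def IsSpectrumBinvRa (f g : ℝ → ℝ) (C : ℝ → ℂ) : Prop :=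
  P.InFormDomain f g C ∧ ∀ K, P.InFormDomain f g K → formB f g C K = P.formR f g K

/-- `⟨Ra, B⁻¹Ra⟩ + ⟨Qa, a⟩`, where `C` is the spectrum of `B⁻¹Ra`. -/
noncomputable def objective (f g : ℝ → ℝ) (C : ℝ → ℂ) : ℝ :=
  (P.formR f g C + P.formQ f g).re

/-- `(f₀, g₀)`, with `C₀` the spectrum of `(B⁰)⁻¹R⁰a`, solves the optimization problem
`max_{(f, g) ∈ D} ⟨Ra, B⁻¹Ra⟩ + ⟨Qa, a⟩ = ⟨R⁰a, (B⁰)⁻¹R⁰a⟩ + ⟨Q⁰a, a⟩`. -/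
def SolvesExtremal (D : Set ((ℝ → ℝ) × (ℝ → ℝ))) (f₀ g₀ : ℝ → ℝ) (C₀ : ℝ → ℂ) : Prop :=
  (f₀, g₀) ∈ D ∧ P.IsSpectrumBinvRa f₀ g₀ C₀ ∧
    IsGreatest {v | ∃ p ∈ D, ∃ C, P.IsSpectrumBinvRa p.1 p.2 C ∧ v = P.objective p.1 p.2 C}
      (P.objective f₀ g₀ C₀)

/-- The function `A f / (f + g) - C / (f + g)`. -/
noncomputable def charFormula (f g : ℝ → ℝ) (C : ℝ → ℂ) (ω : ℝ) : ℂ :=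
  P.A ω * (f ω / (f ω + g ω) : ℝ) - C ω / (f ω + g ω : ℝ)

end FilteringProblem

open Filter Topology

/-! Everything takes place in the Hilbert space `L_2(f + g)` with measure `(f + g) dω / 2π`. Put `φ
= A f / (f + g)`. Completing the square gives `Δ(h; f, g) = ‖h - φ‖² + ⟨Qa, a⟩`, so the optimal `h`
is the projection of `φ` onto the closed span of the observed exponentials. The functions `C / (f +
g)`, with `C` in the form domain, make up the orthogonal complement of that span
(`exists_inFormDomain`), and `Bc = Ra` says that `C / (f + g)` is the component of `φ` there. Hence
`φ - C / (f + g)` is the optimal characteristic, and its error is the objective of the extremal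
problem.

It remains to show that `h⁰` and `f₀` form a saddle point (`SolvesExtremal.saddle`). The difficulty
is that `h⁰` is only known to lie in `L_2^s(f₀ + g)`, while the minimax problem needs it in `L_2^s(f
+ g)` for every `f` of the class. The class is convex and `Δ` is affine in `f`, so take the optimal
`h_n` for `(1 - l_n) f₀ + l_n f` with `l_n ↓ 0`. Extremality of `f₀` gives `Δ(h_n; f, g) ≤ Δ(h⁰; f₀,
g)` and `h_n → h⁰` in `L_2(f₀ + g)`. Comparing the minimizers with each other shows that `h_n` is
Cauchy in `L_2(f + g)`. Since `f₀ + g > 0` almost everywhere, the two limits agree, so `h⁰ ∈ L_2^s(f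
+ g)` and the error bound passes to the limit. Uniqueness follows from the Pythagorean identity at
`f₀`. -/

/-! ### Spectral measures and positivity of the density -/

theorem IsSpectralDensity.add {f g : ℝ → ℝ} (hf : IsSpectralDensity f)
    (hg : IsSpectralDensity g) : IsSpectralDensity (f + g) :=
  ⟨fun ω => add_nonneg (hf.nonneg ω) (hg.nonneg ω), hf.integrable.add hg.integrable⟩

theorem IsSpectralDensity.const_mul {f : ℝ → ℝ} (hf : IsSpectralDensity f) {c : ℝ}
    (hc : 0 ≤ c) : IsSpectralDensity (fun ω => c * f ω) :=
  ⟨fun ω => mul_nonneg hc (hf.nonneg ω), hf.integrable.const_mul c⟩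

theorem IsSpectralDensity.aemeasurable {w : ℝ → ℝ} (hw : IsSpectralDensity w) :
    AEMeasurable (fun ω => ENNReal.ofReal (w ω / (2 * Real.pi))) :=
  (hw.integrable.aemeasurable.div_const _).ennreal_ofReal

theorem IsSpectralDensity.isFiniteMeasure {w : ℝ → ℝ} (hw : IsSpectralDensity w) :
    IsFiniteMeasure (spectralMeasure w) :=
  isFiniteMeasure_withDensity_ofReal (hw.integrable.div_const _).2

theorem spectralMeasure_absolutelyContinuous (w : ℝ → ℝ) :
    spectralMeasure w ≪ volume :=
  withDensity_absolutelyContinuous _ _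

theorem spectralMeasure_add {f g : ℝ → ℝ} (hf : IsSpectralDensity f)
    (hg : IsSpectralDensity g) :
    spectralMeasure (f + g) = spectralMeasure f + spectralMeasure g := by
  ext s hs
  simp only [spectralMeasure, Measure.add_apply, withDensity_apply _ hs]
  rw [← lintegral_add_left' hf.aemeasurable.restrict]
  refine lintegral_congr fun ω => ?_
  rw [Pi.add_apply, add_div, ENNReal.ofReal_add] <;>
    exact div_nonneg (by first | exact hf.nonneg ω | exact hg.nonneg ω) (by positivity)

theorem spectralMeasure_const_mul {f : ℝ → ℝ} {c : ℝ} (hc : 0 ≤ c) :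
    spectralMeasure (fun ω => c * f ω) = ENNReal.ofReal c • spectralMeasure f := by
  ext s hs
  simp only [spectralMeasure, Measure.smul_apply, withDensity_apply _ hs, smul_eq_mul]
  rw [← lintegral_const_mul' _ _ ENNReal.ofReal_ne_top]
  refine lintegral_congr fun ω => ?_
  rw [← ENNReal.ofReal_mul hc, mul_div_assoc]

theorem lintegral_spectralMeasure {w : ℝ → ℝ} (hw : IsSpectralDensity w) (F : ℝ → ℝ≥0∞) :
    ∫⁻ ω, F ω ∂spectralMeasure w =
      ∫⁻ ω, ENNReal.ofReal (w ω / (2 * Real.pi)) * F ω :=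
  lintegral_withDensity_eq_lintegral_mul_non_measurable₀ _ hw.aemeasurable
    (Eventually.of_forall fun _ => ENNReal.ofReal_lt_top) _

theorem integral_spectralMeasure {w : ℝ → ℝ} (hw : IsSpectralDensity w) (F : ℝ → ℂ) :
    ∫ ω, F ω ∂spectralMeasure w = (1 / (2 * Real.pi)) * ∫ ω, w ω * F ω := by
  rw [spectralMeasure, integral_withDensity_eq_integral_toReal_smul₀ hw.aemeasurable
    (Eventually.of_forall fun _ => ENNReal.ofReal_lt_top), ← integral_const_mul]
  refine integral_congr_ae (Eventually.of_forall fun ω => ?_)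
  simp only
  rw [ENNReal.toReal_ofReal (div_nonneg (hw.nonneg ω) (by positivity)), Complex.real_smul]
  push_cast
  ring

theorem ae_spectralMeasure_iff {w : ℝ → ℝ} (hw : IsSpectralDensity w) {p : ℝ → Prop} :
    (∀ᵐ ω ∂spectralMeasure w, p ω) ↔ ∀ᵐ ω, 0 < w ω → p ω := by
  rw [spectralMeasure, ae_withDensity_iff' hw.aemeasurable]
  refine eventually_congr (Eventually.of_forall fun ω => ?_)
  rw [ne_eq, ENNReal.ofReal_eq_zero, not_le, div_pos_iff_of_pos_right (by positivity)]

/-- A function of finite `L_2` size relative to the density `1 / w`, as a function in `L_2(w)`. -/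
theorem memLp_div_spectralMeasure {w : ℝ → ℝ} (hw : IsSpectralDensity w) {K : ℝ → ℂ}
    (hK : AEStronglyMeasurable K) (hfin : ∫⁻ ω, ‖K ω‖ₑ ^ 2 / ENNReal.ofReal (w ω) < ⊤) :
    MemLp (fun ω => K ω / (w ω : ℝ)) 2 (spectralMeasure w) := by
  have hm : AEStronglyMeasurable (fun ω => K ω / (w ω : ℝ)) volume := by
    refine AEMeasurable.aestronglyMeasurable ?_
    exact hK.aemeasurable.div (Complex.measurable_ofReal.comp_aemeasurable
      hw.integrable.aemeasurable)
  refine ⟨hm.mono_ac (spectralMeasure_absolutelyContinuous w), ?_⟩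
  rw [eLpNorm_lt_top_iff_lintegral_rpow_enorm_lt_top (by norm_num) (by norm_num),
    lintegral_spectralMeasure hw]
  refine lt_of_le_of_lt (lintegral_mono fun ω => ?_)
    (lt_of_eq_of_lt (lintegral_const_mul' (ENNReal.ofReal (1 / (2 * Real.pi))) _
      ENNReal.ofReal_ne_top) (ENNReal.mul_lt_top ENNReal.ofReal_lt_top hfin))
  rcases (hw.nonneg ω).eq_or_lt with h | h
  · simp [← h]
  · simp only [ENNReal.toReal_ofNat, ENNReal.rpow_ofNat]
    rw [← ofReal_norm, ← ofReal_norm, ← ENNReal.ofReal_pow (norm_nonneg _),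
      ← ENNReal.ofReal_pow (norm_nonneg _), ← ENNReal.ofReal_div_of_pos h,
      ← ENNReal.ofReal_mul (by positivity), ← ENNReal.ofReal_mul (by positivity)]
    refine ENNReal.ofReal_le_ofReal (le_of_eq ?_)
    rw [norm_div, Complex.norm_real, Real.norm_of_nonneg h.le]
    field_simp

theorem ae_eq_zero_of_lintegral_div_lt_top {w : ℝ → ℝ} (hw : IsSpectralDensity w) {K : ℝ → ℂ}
    (hK : AEStronglyMeasurable K) (hfin : ∫⁻ ω, ‖K ω‖ₑ ^ 2 / ENNReal.ofReal (w ω) < ⊤) :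
    ∀ᵐ ω, w ω = 0 → K ω = 0 := by
  have hm : AEMeasurable (fun ω => ‖K ω‖ₑ ^ 2 / ENNReal.ofReal (w ω)) :=
    (hK.enorm.pow_const 2).div hw.integrable.aemeasurable.ennreal_ofReal
  filter_upwards [ae_lt_top' hm hfin.ne] with ω h h0
  by_contra hne
  simp [h0, ENNReal.div_zero, hne] at h

/-- Finiteness of the integral forces `γ = 0` almost everywhere on `{w = 0}`, but a nontrivial
entire function has only countably many zeros. -/
theorem ae_pos_of_minimalityCondition {w : ℝ → ℝ} (hw : IsSpectralDensity w)
    (h : MinimalityCondition w) : ∀ᵐ ω, 0 < w ω := by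
  obtain ⟨-, γ, -, -, hd, -, ⟨z, hz⟩, hfin⟩ := h
  have hγ : AnalyticOnNhd ℂ γ univ := fun z _ => hd.analyticAt z
  have hcount : (γ ⁻¹' {0}).Countable := by
    have := hγ.preimage_zero_mem_codiscrete hz
    have hd := (mem_codiscrete'.1 this).2
    rw [preimage_compl, compl_compl] at hd
    have := hd.to_subtype
    exact countable_of_Lindelof_of_discrete
  have hcount' : {ω : ℝ | γ ω = 0}.Countable :=
    hcount.preimage Complex.ofReal_injective
  have hK : AEStronglyMeasurable (fun ω : ℝ => γ ω) :=
    (hd.continuous.comp Complex.continuous_ofReal).aestronglyMeasurable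
  filter_upwards [ae_eq_zero_of_lintegral_div_lt_top hw hK hfin,
    compl_mem_ae_iff.2 (hcount'.measure_zero volume)] with ω h1 h2
  exact (hw.nonneg ω).lt_of_ne fun h => h2 (h1 h.symm)

theorem ae_of_ae_spectralMeasure {w : ℝ → ℝ} (hw : IsSpectralDensity w)
    (hpos : ∀ᵐ ω, 0 < w ω) {p : ℝ → Prop} (h : ∀ᵐ ω ∂spectralMeasure w, p ω) :
    ∀ᵐ ω, p ω := by
  filter_upwards [(ae_spectralMeasure_iff hw).1 h, hpos] with ω h1 h2 using h1 h2

/-! ### Trigonometric polynomials in `L_2(μ)` -/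

/-- The trigonometric polynomials with frequencies in `s`, as a subspace of `L_2(μ)`. -/
noncomputable def expSpan (s : Set ℝ) (μ : Measure ℝ) : Submodule ℂ (Lp ℂ 2 μ) where
  carrier := {u | ∃ p ∈ Submodule.span ℂ
    ((fun (t ω : ℝ) => Complex.exp (Complex.I * t * ω)) '' s), u =ᵐ[μ] p}
  zero_mem' := ⟨0, Submodule.zero_mem _, Lp.coeFn_zero _ _ _⟩
  add_mem' := by
    rintro u v ⟨p, hp, hup⟩ ⟨q, hq, hvq⟩
    exact ⟨p + q, Submodule.add_mem _ hp hq, (Lp.coeFn_add u v).trans (hup.add hvq)⟩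
  smul_mem' := by
    rintro c u ⟨p, hp, hup⟩
    exact ⟨c • p, Submodule.smul_mem _ c hp, (Lp.coeFn_smul c u).trans (hup.const_smul c)⟩

theorem norm_exp_I_mul_mul (t ω : ℝ) : ‖Complex.exp (Complex.I * t * ω)‖ = 1 := by
  rw [show Complex.I * t * ω = ((t * ω : ℝ) : ℂ) * Complex.I by push_cast; ring,
    Complex.norm_exp_ofReal_mul_I]

theorem conj_exp_I_mul_mul (t ω : ℝ) :
    conj (Complex.exp (Complex.I * t * ω)) = Complex.exp (-(Complex.I * t * ω)) := by
  rw [← Complex.exp_conj]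
  simp

theorem memLp_exp (t : ℝ) (μ : Measure ℝ) [IsFiniteMeasure μ] :
    MemLp (fun ω : ℝ => Complex.exp (Complex.I * t * ω)) 2 μ :=
  MemLp.of_bound (by fun_prop) 1 (Eventually.of_forall fun ω => (norm_exp_I_mul_mul t ω).le)

/-- Passes from the span of functions to classes in `L_2(μ)`. It is applied with `V` the polynomials
themselves and with `V` the orthogonal complement of one vector. -/
theorem exists_Lp_eq_of_mem_span_exp {s : Set ℝ} {μ : Measure ℝ} [IsFiniteMeasure μ]
    {V : Submodule ℂ (Lp ℂ 2 μ)} (hV : ∀ t ∈ s, (memLp_exp t μ).toLp _ ∈ V) {p : ℝ → ℂ}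
    (hp : p ∈ Submodule.span ℂ ((fun (t ω : ℝ) => Complex.exp (Complex.I * t * ω)) '' s)) :
    ∃ u ∈ V, u =ᵐ[μ] p := by
  induction hp using Submodule.span_induction with
  | mem x hx =>
    obtain ⟨t, ht, rfl⟩ := hx
    exact ⟨_, hV t ht, MemLp.coeFn_toLp _⟩
  | zero => exact ⟨0, V.zero_mem, Lp.coeFn_zero _ _ _⟩
  | add x y _ _ hx hy =>
    obtain ⟨u, hu, hux⟩ := hx
    obtain ⟨v, hv, hvy⟩ := hy
    exact ⟨u + v, V.add_mem hu hv, (Lp.coeFn_add u v).trans (hux.add hvy)⟩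
  | smul c x _ hx =>
    obtain ⟨u, hu, hux⟩ := hx
    exact ⟨c • u, V.smul_mem c hu, (Lp.coeFn_smul c u).trans (hux.const_smul c)⟩

theorem toLp_exp_mem_expSpan {s : Set ℝ} (μ : Measure ℝ) [IsFiniteMeasure μ] {t : ℝ}
    (ht : t ∈ s) : (memLp_exp t μ).toLp _ ∈ expSpan s μ :=
  ⟨_, Submodule.subset_span ⟨t, ht, rfl⟩, MemLp.coeFn_toLp _⟩

theorem inner_toLp_toLp {μ : Measure ℝ} {F G : ℝ → ℂ} (hF : MemLp F 2 μ) (hG : MemLp G 2 μ) :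
    inner ℂ (hF.toLp F) (hG.toLp G) = ∫ ω, G ω * conj (F ω) ∂μ := by
  rw [L2.inner_def]
  refine integral_congr_ae ?_
  filter_upwards [hF.coeFn_toLp, hG.coeFn_toLp] with ω h1 h2
  rw [h1, h2, RCLike.inner_apply]

theorem toLp_mem_orthogonal_expSpan_iff {s : Set ℝ} {μ : Measure ℝ} [IsFiniteMeasure μ]
    {k : ℝ → ℂ} (hk : MemLp k 2 μ) :
    hk.toLp k ∈ (expSpan s μ)ᗮ ↔
      ∀ t ∈ s, ∫ ω, k ω * Complex.exp (-(Complex.I * t * ω)) ∂μ = 0 := by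
  have key (t : ℝ) : inner ℂ ((memLp_exp t μ).toLp _) (hk.toLp k) =
      ∫ ω, k ω * Complex.exp (-(Complex.I * t * ω)) ∂μ := by
    rw [inner_toLp_toLp]
    simp only [conj_exp_I_mul_mul]
  constructor
  · intro h t ht
    rw [← key]
    exact (Submodule.mem_orthogonal _ _).1 h _ (toLp_exp_mem_expSpan μ ht)
  · intro h
    refine (Submodule.mem_orthogonal _ _).2 ?_
    rintro u ⟨p, hp, hup⟩
    have hV : ∀ t ∈ s, (memLp_exp t μ).toLp _ ∈ (ℂ ∙ hk.toLp k)ᗮ := fun t ht =>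
      Submodule.mem_orthogonal_singleton_iff_inner_left.2 ((key t).trans (h t ht))
    obtain ⟨v, hv, hvp⟩ := exists_Lp_eq_of_mem_span_exp hV hp
    obtain rfl : u = v := Lp.ext (hup.trans hvp.symm)
    exact Submodule.mem_orthogonal_singleton_iff_inner_left.1 hv

theorem norm_toLp_sq {μ : Measure ℝ} {F : ℝ → ℂ} (hF : MemLp F 2 μ) :
    ∫⁻ ω, ‖F ω‖ₑ ^ 2 ∂μ = ENNReal.ofReal (‖hF.toLp F‖ ^ 2) := by
  rw [Lp.norm_toLp, ENNReal.ofReal_pow ENNReal.toReal_nonneg, ENNReal.ofReal_toReal hF.2.ne]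
  have := eLpNorm_nnreal_pow_eq_lintegral (μ := μ) (f := F) (p := 2) (by norm_num)
  norm_num at this
  exact_mod_cast this.symm

/-! ### The spaces `L_2^s(w)` and the function `A` -/

namespace FilteringProblem

variable (P : FilteringProblem)

theorem mem_L2s_iff {w : ℝ → ℝ} (hw : IsSpectralDensity w) {h : ℝ → ℂ} :
    h ∈ P.L2s w ↔ ∃ hm : MemLp h 2 (spectralMeasure w),
      hm.toLp h ∈ (expSpan P.observed (spectralMeasure w)).topologicalClosure := by
  have := hw.isFiniteMeasure
  refine ⟨fun ⟨hm, H⟩ => ⟨hm, ?_⟩, fun ⟨hm, H⟩ => ⟨hm, fun ε hε => ?_⟩⟩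
  · refine EMetric.mem_closure_iff.2 fun ε hε => ?_
    obtain ⟨p, hp, hlt⟩ := H ε hε
    obtain ⟨u, hu, hup⟩ := exists_Lp_eq_of_mem_span_exp
      (fun t ht => toLp_exp_mem_expSpan (spectralMeasure w) ht) hp
    refine ⟨u, hu, ?_⟩
    rwa [Lp.edist_def, eLpNorm_congr_ae (hm.coeFn_toLp.sub hup)]
  · obtain ⟨u, ⟨p, hp, hup⟩, hlt⟩ := EMetric.mem_closure_iff.1 H ε hε
    refine ⟨p, hp, ?_⟩
    rwa [Lp.edist_def, eLpNorm_congr_ae (hm.coeFn_toLp.sub hup)] at hlt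

theorem not_mem_T_iff {t : ℝ} : t ∉ P.T ↔ t ∈ P.observed := by
  simp [T, observed, and_comm]

/-- The norm of `L_2(w')` is at most a constant times that of `L_2(w)`, so the same polynomials
approximate in both. -/
theorem L2s_subset_of_le {w w' : ℝ → ℝ} {c : ℝ≥0∞} (hc : c ≠ ⊤)
    (hle : spectralMeasure w' ≤ c • spectralMeasure w) : P.L2s w ⊆ P.L2s w' := by
  rintro h ⟨hm, H⟩
  refine ⟨hm.of_measure_le_smul hc hle, fun ε hε => ?_⟩
  have hb : c ^ (1 / (2 : ℝ≥0∞)).toReal ≠ ⊤ := ENNReal.rpow_ne_top_of_nonneg (by simp) hc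
  -- If the constant is zero, `ε` cannot be divided by it, but then every polynomial is at distance
  -- zero.
  rcases eq_or_ne (c ^ (1 / (2 : ℝ≥0∞)).toReal) 0 with h0 | h0
  · obtain ⟨p, hp, -⟩ := H ⊤ (by simp)
    refine ⟨p, hp, lt_of_le_of_lt (eLpNorm_le_of_measure_le_smul hle) ?_⟩
    rw [h0, zero_smul]
    exact hε
  · obtain ⟨p, hp, hlt⟩ := H (ε / c ^ (1 / (2 : ℝ≥0∞)).toReal) (ENNReal.div_pos hε.ne' hb)
    refine ⟨p, hp, lt_of_le_of_lt (eLpNorm_le_of_measure_le_smul hle) ?_⟩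
    rw [smul_eq_mul, mul_comm]
    exact (ENNReal.lt_div_iff_mul_lt (Or.inl h0) (Or.inl hb)).1 hlt

theorem continuous_A (hP : P.IsAdmissible) : Continuous P.A := by
  refine continuous_of_dominated (bound := fun t => ‖P.a t‖) (fun ω => ?_)
    (fun ω => Eventually.of_forall fun t => ?_) hP.integrable_a.norm
    (Eventually.of_forall fun t => by fun_prop)
  · exact hP.integrable_a.1.mul (by fun_prop)
  · rw [norm_mul, ← conj_exp_I_mul_mul, RCLike.norm_conj, norm_exp_I_mul_mul, mul_one]

theorem norm_A_le (ω : ℝ) : ‖P.A ω‖ ≤ ∫ t in P.Rs, ‖P.a t‖ := by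
  refine (norm_integral_le_integral_norm _).trans (le_of_eq (integral_congr_ae ?_))
  refine Eventually.of_forall fun t => ?_
  simp only
  rw [norm_mul, ← conj_exp_I_mul_mul, RCLike.norm_conj, norm_exp_I_mul_mul, mul_one]

/-- The spectral characteristic `A f / (f + g)` of the estimate that uses all observations. -/
noncomputable def wienerChar (f g : ℝ → ℝ) (ω : ℝ) : ℂ := P.A ω * (f ω / (f ω + g ω) : ℝ)

theorem memLp_wienerChar (hP : P.IsAdmissible) {f g : ℝ → ℝ} (hf : IsSpectralDensity f)
    (hg : IsSpectralDensity g) : MemLp (P.wienerChar f g) 2 (spectralMeasure (f + g)) := by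
  have := (hf.add hg).isFiniteMeasure
  refine MemLp.of_bound (C := ∫ t in P.Rs, ‖P.a t‖) ?_ (Eventually.of_forall fun ω => ?_)
  · refine AEStronglyMeasurable.mono_ac (spectralMeasure_absolutelyContinuous _) ?_
    exact (P.continuous_A hP).aestronglyMeasurable.mul
      (Complex.measurable_ofReal.comp_aemeasurable (hf.integrable.aemeasurable.div
        (hf.integrable.aemeasurable.add hg.integrable.aemeasurable))).aestronglyMeasurable
  · rw [wienerChar, norm_mul, Complex.norm_real, Real.norm_of_nonneg
      (div_nonneg (hf.nonneg ω) (add_nonneg (hf.nonneg ω) (hg.nonneg ω)))]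
    refine (mul_le_of_le_one_right (norm_nonneg _) ?_).trans (P.norm_A_le ω)
    exact div_le_one_of_le₀ (le_add_of_nonneg_right (hg.nonneg ω))
      (add_nonneg (hf.nonneg ω) (hg.nonneg ω))

end FilteringProblem

/-! ### The form domain as an orthogonal complement -/

namespace FilteringProblem

variable (P : FilteringProblem)

section FormDomain

variable {P} {f g : ℝ → ℝ} {C K : ℝ → ℂ}

theorem InFormDomain.memLp (hf : IsSpectralDensity f) (hg : IsSpectralDensity g)
    (hK : P.InFormDomain f g K) :
    MemLp (fun ω => K ω / (f ω + g ω : ℝ)) 2 (spectralMeasure (f + g)) :=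
  memLp_div_spectralMeasure (hf.add hg) hK.aestronglyMeasurable hK.finite_energy

theorem signal_eq_integral (hf : IsSpectralDensity f) (hg : IsSpectralDensity g)
    (hK : ∀ᵐ ω, f ω + g ω = 0 → K ω = 0) (t : ℝ) :
    signal K t = ∫ ω, K ω / (f ω + g ω : ℝ) * Complex.exp (-(Complex.I * t * ω))
      ∂spectralMeasure (f + g) := by
  rw [integral_spectralMeasure (hf.add hg), signal]
  congr 1
  refine integral_congr_ae ?_
  filter_upwards [hK] with ω h
  simp only [Pi.add_apply]
  rcases eq_or_ne (f ω + g ω) 0 with h0 | h0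
  · simp [h h0, h0]
  · have : ((f ω + g ω : ℝ) : ℂ) ≠ 0 := by exact_mod_cast h0
    field_simp

/-- The inner product of `e^{itω}` with `K / (f + g)` is the value at `t` of the signal of `K`,
which vanishes at observed times. -/
theorem InFormDomain.toLp_mem_orthogonal (hf : IsSpectralDensity f) (hg : IsSpectralDensity g)
    (hK : P.InFormDomain f g K) :
    (hK.memLp hf hg).toLp _ ∈ (expSpan P.observed (spectralMeasure (f + g)))ᗮ := by
  have := (hf.add hg).isFiniteMeasure
  refine (toLp_mem_orthogonal_expSpan_iff _).2 fun t ht => ?_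
  rw [← signal_eq_integral hf hg (ae_eq_zero_of_lintegral_div_lt_top (hf.add hg)
    hK.aestronglyMeasurable hK.finite_energy)]
  exact hK.supported t (P.not_mem_T_iff.2 ht)

/-- Every element of `L_2(f + g)` orthogonal to the observations comes from the form domain. -/
theorem exists_inFormDomain (hf : IsSpectralDensity f) (hg : IsSpectralDensity g)
    {k : Lp ℂ 2 (spectralMeasure (f + g))}
    (hk : k ∈ (expSpan P.observed (spectralMeasure (f + g)))ᗮ) :
    ∃ (K : ℝ → ℂ) (hK : P.InFormDomain f g K), (hK.memLp hf hg).toLp _ = k := by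
  have := (hf.add hg).isFiniteMeasure
  have hw := hf.add hg
  have hquot : (fun ω => k ω * (f ω + g ω : ℝ) / (f ω + g ω : ℝ))
      =ᵐ[spectralMeasure (f + g)] k := by
    refine (ae_spectralMeasure_iff hw).2 (Eventually.of_forall fun ω h => ?_)
    have : ((f ω + g ω : ℝ) : ℂ) ≠ 0 := by exact_mod_cast h.ne'
    field_simp
  -- Multiplying by `f + g` inverts `K ↦ K / (f + g)` up to null sets of the spectral measure.
  have hK : P.InFormDomain f g (fun ω => k ω * (f ω + g ω : ℝ)) := by
    refine ⟨?_, ?_, fun t ht => ?_⟩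
    · exact (Lp.stronglyMeasurable k).aestronglyMeasurable.mul
        (Complex.measurable_ofReal.comp_aemeasurable
          hw.integrable.aemeasurable).aestronglyMeasurable
    · have hfin : ∫⁻ ω, ‖k ω‖ₑ ^ 2 ∂spectralMeasure (f + g) < ⊤ := by
        rw [norm_toLp_sq (Lp.memLp k)]
        exact ENNReal.ofReal_lt_top
      rw [lintegral_spectralMeasure hw] at hfin
      refine lt_of_le_of_lt (lintegral_mono fun ω => ?_)
        (lt_of_eq_of_lt (lintegral_const_mul' (ENNReal.ofReal (2 * Real.pi)) _
          ENNReal.ofReal_ne_top) (ENNReal.mul_lt_top ENNReal.ofReal_lt_top hfin))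
      rcases (hw.nonneg ω).eq_or_lt with h | h <;> rw [Pi.add_apply] at h
      · simp [← h]
      · rw [Pi.add_apply, ← ofReal_norm, ← ofReal_norm, ← ENNReal.ofReal_pow (norm_nonneg _),
          ← ENNReal.ofReal_pow (norm_nonneg _), ← ENNReal.ofReal_div_of_pos h,
          ← ENNReal.ofReal_mul (by positivity), ← ENNReal.ofReal_mul (by positivity)]
        refine ENNReal.ofReal_le_ofReal (le_of_eq ?_)
        rw [norm_mul, Complex.norm_real, Real.norm_of_nonneg h.le]
        field_simp
    · rw [signal_eq_integral hf hg (Eventually.of_forall fun ω h => by simp [h])]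
      have h0 := (toLp_mem_orthogonal_expSpan_iff (Lp.memLp k)).1
        (by rwa [Lp.toLp_coeFn]) t (P.not_mem_T_iff.1 ht)
      rw [← h0]
      refine integral_congr_ae ?_
      filter_upwards [hquot] with ω h
      rw [h]
  refine ⟨_, hK, ?_⟩
  refine Lp.ext ((MemLp.coeFn_toLp _).trans hquot)

theorem formB_eq_inner (hf : IsSpectralDensity f) (hg : IsSpectralDensity g)
    (hC : P.InFormDomain f g C) (hK : P.InFormDomain f g K) :
    formB f g C K = inner ℂ ((hK.memLp hf hg).toLp _) ((hC.memLp hf hg).toLp _) := by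
  rw [inner_toLp_toLp, integral_spectralMeasure (hf.add hg), formB]
  congr 1
  refine integral_congr_ae (Eventually.of_forall fun ω => ?_)
  simp only [Pi.add_apply, map_div₀, Complex.conj_ofReal]
  rcases eq_or_ne (f ω + g ω) 0 with h0 | h0
  · simp [h0]
  · have : ((f ω + g ω : ℝ) : ℂ) ≠ 0 := by exact_mod_cast h0
    rw [Complex.ofReal_div, Complex.ofReal_one]
    field_simp

theorem formR_eq_inner (hP : P.IsAdmissible) (hf : IsSpectralDensity f)
    (hg : IsSpectralDensity g) (hK : P.InFormDomain f g K) :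
    P.formR f g K =
      inner ℂ ((hK.memLp hf hg).toLp _) ((P.memLp_wienerChar hP hf hg).toLp _) := by
  rw [inner_toLp_toLp, integral_spectralMeasure (hf.add hg), formR]
  congr 1
  refine integral_congr_ae (Eventually.of_forall fun ω => ?_)
  simp only [Pi.add_apply, map_div₀, Complex.conj_ofReal, wienerChar]
  rcases eq_or_ne (f ω + g ω) 0 with h0 | h0
  · simp [h0]
  · have : ((f ω + g ω : ℝ) : ℂ) ≠ 0 := by exact_mod_cast h0
    field_simp

/-- The equation `Bc = Ra` says that `φ - C / (f + g)` is orthogonal to every `K / (f + g)`. These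
fill the orthogonal complement of the polynomials, and the double complement is the closure. -/
theorem isSpectrumBinvRa_iff (hP : P.IsAdmissible) (hf : IsSpectralDensity f)
    (hg : IsSpectralDensity g) (hC : P.InFormDomain f g C) :
    P.IsSpectrumBinvRa f g C ↔
      (P.memLp_wienerChar hP hf hg).toLp _ - (hC.memLp hf hg).toLp _ ∈
        (expSpan P.observed (spectralMeasure (f + g))).topologicalClosure := by
  rw [← Submodule.orthogonal_orthogonal_eq_closure]
  constructor
  · intro h
    refine (Submodule.mem_orthogonal _ _).2 fun k hk => ?_
    obtain ⟨K, hK, rfl⟩ := exists_inFormDomain hf hg hk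
    rw [inner_sub_right, ← formR_eq_inner hP hf hg hK, ← formB_eq_inner hf hg hC hK, h.2 K hK,
      sub_self]
  · refine fun h => ⟨hC, fun K hK => ?_⟩
    have := (Submodule.mem_orthogonal _ _).1 h _ (hK.toLp_mem_orthogonal hf hg)
    rw [inner_sub_right, ← formR_eq_inner hP hf hg hK, ← formB_eq_inner hf hg hC hK,
      sub_eq_zero] at this
    exact this.symm

theorem exists_isSpectrumBinvRa (hP : P.IsAdmissible) (hf : IsSpectralDensity f)
    (hg : IsSpectralDensity g) : ∃ C, P.IsSpectrumBinvRa f g C := by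
  set V := (expSpan P.observed (spectralMeasure (f + g))).topologicalClosure with hV
  have : CompleteSpace V := (Submodule.isClosed_topologicalClosure _).completeSpace_coe
  obtain ⟨y, hy, z, hz, hyz⟩ :=
    V.exists_add_mem_mem_orthogonal ((P.memLp_wienerChar hP hf hg).toLp _)
  rw [hV, Submodule.orthogonal_closure] at hz
  obtain ⟨C, hC, rfl⟩ := exists_inFormDomain hf hg hz
  refine ⟨C, (isSpectrumBinvRa_iff hP hf hg hC).2 ?_⟩
  rwa [hyz, add_sub_cancel_right]

end FormDomain

/-- `⟨Qa, a⟩` as a real number. -/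
noncomputable def noiseTerm (f g : ℝ → ℝ) : ℝ :=
  (1 / (2 * Real.pi)) * ∫ ω, ‖P.A ω‖ ^ 2 * (f ω * g ω / (f ω + g ω))

theorem formQ_eq (f g : ℝ → ℝ) : P.formQ f g = P.noiseTerm f g := by
  rw [formQ, noiseTerm, Complex.ofReal_mul, ← integral_complex_ofReal]
  push_cast
  congr 1
  refine integral_congr_ae (Eventually.of_forall fun ω => ?_)
  simp only
  rw [mul_right_comm, Complex.mul_conj']

/-! ### The mean-square error as a squared distance -/

section Error

variable {P} {f g : ℝ → ℝ} {h : ℝ → ℂ}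

theorem noiseTerm_nonneg (hf : IsSpectralDensity f) (hg : IsSpectralDensity g) :
    0 ≤ P.noiseTerm f g :=
  mul_nonneg (by positivity) (integral_nonneg fun ω => mul_nonneg (by positivity)
    (div_nonneg (mul_nonneg (hf.nonneg ω) (hg.nonneg ω))
      (add_nonneg (hf.nonneg ω) (hg.nonneg ω))))

theorem integrable_noiseTerm (hP : P.IsAdmissible) (hf : IsSpectralDensity f)
    (hg : IsSpectralDensity g) :
    Integrable fun ω => ‖P.A ω‖ ^ 2 * (f ω * g ω / (f ω + g ω)) := by
  have h1 : Integrable fun ω => f ω * g ω / (f ω + g ω) := by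
    refine hf.integrable.mono' ((hf.integrable.aemeasurable.mul
      hg.integrable.aemeasurable).div (hf.integrable.aemeasurable.add
      hg.integrable.aemeasurable)).aestronglyMeasurable (Eventually.of_forall fun ω => ?_)
    have hfω := hf.nonneg ω
    have hgω := hg.nonneg ω
    rw [Real.norm_of_nonneg (by positivity), mul_div_assoc]
    exact mul_le_of_le_one_right hfω (div_le_one_of_le₀ (by linarith) (by linarith))
  refine h1.bdd_mul (c := (∫ t in P.Rs, ‖P.a t‖) ^ 2)
    ((P.continuous_A hP).norm.pow 2).aestronglyMeasurable (Eventually.of_forall fun ω => ?_)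
  rw [norm_pow, norm_norm]
  exact pow_le_pow_left₀ (norm_nonneg _) (P.norm_A_le ω) 2

/-- Completing the square in the mean-square error. -/
theorem error_density_eq {x y : ℝ} (hx : 0 ≤ x) (hy : 0 ≤ y) (a z : ℂ) :
    x * ‖a - z‖ ^ 2 + y * ‖z‖ ^ 2 =
      (x + y) * ‖z - a * (x / (x + y) : ℝ)‖ ^ 2 + ‖a‖ ^ 2 * (x * y / (x + y)) := by
  rcases (add_nonneg hx hy).eq_or_lt with h | h
  · obtain rfl : x = 0 := by linarith
    obtain rfl : y = 0 := by linarith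
    simp
  · simp only [Complex.sq_norm, Complex.normSq_apply, Complex.sub_re, Complex.sub_im,
      Complex.mul_re, Complex.mul_im, Complex.ofReal_re, Complex.ofReal_im]
    field_simp
    ring

theorem error_eq (hP : P.IsAdmissible) (hf : IsSpectralDensity f) (hg : IsSpectralDensity g)
    (hh : MemLp h 2 (spectralMeasure (f + g))) :
    P.Δ h f g = ENNReal.ofReal
      (‖hh.toLp h - (P.memLp_wienerChar hP hf hg).toLp _‖ ^ 2 + P.noiseTerm f g) := by
  have hadd := spectralMeasure_add hf hg
  -- `h` is measurable only up to null sets of the spectral measure of `f + g`. Splitting the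
  -- Lebesgue integrals needs a measurable representative.
  obtain ⟨h', hm, hae⟩ := hh.1
  have hle1 : spectralMeasure f ≪ spectralMeasure (f + g) :=
    hadd ▸ Measure.absolutelyContinuous_of_le (Measure.le_add_right le_rfl)
  have hle2 : spectralMeasure g ≪ spectralMeasure (f + g) :=
    hadd ▸ Measure.absolutelyContinuous_of_le (Measure.le_add_left le_rfl)
  rw [ENNReal.ofReal_add (by positivity) (noiseTerm_nonneg hf hg), ← MemLp.toLp_sub,
    ← norm_toLp_sq, Δ, noiseTerm, ← integral_const_mul, ofReal_integral_eq_lintegral_ofReal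
      ((integrable_noiseTerm hP hf hg).const_mul _) (Eventually.of_forall fun ω => ?_)]
  · rw [lintegral_congr_ae (μ := spectralMeasure f) (g := fun ω => ‖P.A ω - h' ω‖ₑ ^ 2)
      (by filter_upwards [hle1.ae_le hae] with ω h; rw [h]),
      lintegral_congr_ae (μ := spectralMeasure g) (g := fun ω => ‖h' ω‖ₑ ^ 2)
      (by filter_upwards [hle2.ae_le hae] with ω h; rw [h]),
      lintegral_congr_ae (μ := spectralMeasure (f + g))
      (g := fun ω => ‖h' ω - P.wienerChar f g ω‖ₑ ^ 2)
      (by filter_upwards [hae] with ω h; rw [Pi.sub_apply, h]),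
      lintegral_spectralMeasure hf, lintegral_spectralMeasure hg,
      lintegral_spectralMeasure (hf.add hg), ← lintegral_add_right', ← lintegral_add_right']
    · refine lintegral_congr fun ω => ?_
      have hfω := hf.nonneg ω
      have hgω := hg.nonneg ω
      simp only [← ofReal_norm, Pi.add_apply]
      rw [← ENNReal.ofReal_pow (norm_nonneg _), ← ENNReal.ofReal_pow (norm_nonneg _),
        ← ENNReal.ofReal_pow (norm_nonneg _), ← ENNReal.ofReal_mul (by positivity),
        ← ENNReal.ofReal_mul (by positivity), ← ENNReal.ofReal_mul (by positivity),
        ← ENNReal.ofReal_add (by positivity) (by positivity),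
        ← ENNReal.ofReal_add (by positivity) (by positivity)]
      congr 1
      have := error_density_eq hfω hgω (P.A ω) (h' ω)
      rw [wienerChar]
      linear_combination (1 / (2 * Real.pi)) * this
    · exact ((integrable_noiseTerm hP hf hg).const_mul _).aemeasurable.ennreal_ofReal
    · exact hg.aemeasurable.mul (hm.enorm.pow_const 2).aemeasurable
  · have hfω := hf.nonneg ω
    have hgω := hg.nonneg ω
    positivity

end Error

end FilteringProblem

/-! ### The optimal estimate as an orthogonal projection -/

namespace FilteringProblem

section Projection

variable {P : FilteringProblem} {f g : ℝ → ℝ} {C : ℝ → ℂ}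

theorem IsSpectrumBinvRa.memLp_charFormula (hP : P.IsAdmissible) (hf : IsSpectralDensity f)
    (hg : IsSpectralDensity g) (hC : P.IsSpectrumBinvRa f g C) :
    MemLp (P.charFormula f g C) 2 (spectralMeasure (f + g)) :=
  (P.memLp_wienerChar hP hf hg).sub (hC.1.memLp hf hg)

theorem IsSpectrumBinvRa.toLp_charFormula (hP : P.IsAdmissible) (hf : IsSpectralDensity f)
    (hg : IsSpectralDensity g) (hC : P.IsSpectrumBinvRa f g C) :
    (hC.memLp_charFormula hP hf hg).toLp _ =
      (P.memLp_wienerChar hP hf hg).toLp _ - (hC.1.memLp hf hg).toLp _ :=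
  rfl

theorem IsSpectrumBinvRa.charFormula_mem_L2s (hP : P.IsAdmissible) (hf : IsSpectralDensity f)
    (hg : IsSpectralDensity g) (hC : P.IsSpectrumBinvRa f g C) :
    P.charFormula f g C ∈ P.L2s (f + g) :=
  (P.mem_L2s_iff (hf.add hg)).2 ⟨hC.memLp_charFormula hP hf hg,
    (isSpectrumBinvRa_iff hP hf hg hC.1).1 hC⟩

/-- The error of an arbitrary estimate exceeds that of `charFormula` by the squared distance. -/
theorem IsSpectrumBinvRa.error_eq_add (hP : P.IsAdmissible) (hf : IsSpectralDensity f)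
    (hg : IsSpectralDensity g) (hC : P.IsSpectrumBinvRa f g C) {h : ℝ → ℂ}
    (hh : h ∈ P.L2s (f + g)) :
    P.Δ h f g = P.Δ (P.charFormula f g C) f g +
      ∫⁻ ω, ‖h ω - P.charFormula f g C ω‖ₑ ^ 2 ∂spectralMeasure (f + g) := by
  obtain ⟨hm, hmem⟩ := (P.mem_L2s_iff (hf.add hg)).1 hh
  have hcm := hC.memLp_charFormula hP hf hg
  have hcmem := (isSpectrumBinvRa_iff hP hf hg hC.1).1 hC
  have hn : ∫⁻ ω, ‖h ω - P.charFormula f g C ω‖ₑ ^ 2 ∂spectralMeasure (f + g) =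
      ENNReal.ofReal (‖hm.toLp h - hcm.toLp _‖ ^ 2) := norm_toLp_sq (hm.sub hcm)
  have horth := hC.1.toLp_mem_orthogonal hf hg
  rw [← Submodule.orthogonal_closure] at horth
  rw [hn, error_eq hP hf hg hm, error_eq hP hf hg hcm, ← ENNReal.ofReal_add
    (add_nonneg (by positivity) (noiseTerm_nonneg hf hg)) (by positivity)]
  rw [hC.toLp_charFormula hP hf hg]
  set φ := (P.memLp_wienerChar hP hf hg).toLp _
  set ψ := (hC.1.memLp hf hg).toLp _
  have h0 : inner ℂ (hm.toLp h - (φ - ψ)) ψ = 0 :=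
    (Submodule.mem_orthogonal _ _).1 horth _ (Submodule.sub_mem _ hmem hcmem)
  have h2 : ‖hm.toLp h - φ‖ ^ 2 = ‖hm.toLp h - (φ - ψ)‖ ^ 2 + ‖ψ‖ ^ 2 := by
    have := @norm_sub_sq ℂ _ _ _ _ (hm.toLp h - (φ - ψ)) ψ
    rw [h0, show hm.toLp h - (φ - ψ) - ψ = hm.toLp h - φ by abel] at this
    simpa using this
  rw [h2, show φ - ψ - φ = -ψ by abel, norm_neg]
  congr 1
  ring

/-- The distance from `φ` to its projection is the norm of `C / (f + g)`, whose square is `⟨Bc, c⟩ =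
⟨Ra, c⟩`. -/
theorem IsSpectrumBinvRa.error_eq_objective (hP : P.IsAdmissible) (hf : IsSpectralDensity f)
    (hg : IsSpectralDensity g) (hC : P.IsSpectrumBinvRa f g C) :
    P.Δ (P.charFormula f g C) f g = ENNReal.ofReal (P.objective f g C) := by
  rw [error_eq hP hf hg (hC.memLp_charFormula hP hf hg), hC.toLp_charFormula hP hf hg,
    sub_sub_cancel_left, norm_neg, objective, formQ_eq, ← hC.2 C hC.1,
    formB_eq_inner hf hg hC.1 hC.1, inner_self_eq_norm_sq_to_K, Complex.add_re,
    Complex.ofReal_re]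
  norm_cast

theorem IsSpectrumBinvRa.isOptimal (hP : P.IsAdmissible) (hf : IsSpectralDensity f)
    (hg : IsSpectralDensity g) (hC : P.IsSpectrumBinvRa f g C) :
    P.IsOptimal f g (P.charFormula f g C) :=
  ⟨hC.charFormula_mem_L2s hP hf hg, fun h hh => by
    rw [hC.error_eq_add hP hf hg hh]
    exact le_self_add⟩

end Projection

/-! ### Convex mixtures of densities -/

section Mixture

variable {P : FilteringProblem} {f₀ f g : ℝ → ℝ} {h : ℝ → ℂ} {l : ℝ}

theorem error_mixture (hf₀ : IsSpectralDensity f₀) (hf : IsSpectralDensity f) (h0 : 0 ≤ l)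
    (h1 : l ≤ 1) :
    P.Δ h ((fun ω => (1 - l) * f₀ ω) + fun ω => l * f ω) g =
      ENNReal.ofReal (1 - l) * P.Δ h f₀ g + ENNReal.ofReal l * P.Δ h f g := by
  have h2 : 0 ≤ 1 - l := by linarith
  have hsum : ENNReal.ofReal (1 - l) + ENNReal.ofReal l = 1 := by
    rw [← ENNReal.ofReal_add h2 h0, sub_add_cancel, ENNReal.ofReal_one]
  simp only [Δ]
  rw [spectralMeasure_add (hf₀.const_mul h2) (hf.const_mul h0), spectralMeasure_const_mul h2,
    spectralMeasure_const_mul h0, lintegral_add_measure, lintegral_smul_measure,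
    lintegral_smul_measure, smul_eq_mul, smul_eq_mul]
  -- The noise density is common to both pairs, so its term is split with weights `1 - l` and `l`.
  nth_rw 1 [← one_mul (∫⁻ ω, ‖h ω‖ₑ ^ 2 ∂spectralMeasure g)]
  rw [← hsum]
  ring

theorem mixture_add_noise (f₀ f g : ℝ → ℝ) (l : ℝ) :
    ((fun ω => (1 - l) * f₀ ω) + fun ω => l * f ω) + g =
      (fun ω => (1 - l) * (f₀ + g) ω) + fun ω => l * (f + g) ω := by
  ext ω
  simp only [Pi.add_apply]
  ring

theorem spectralMeasure_mixture (hf₀ : IsSpectralDensity f₀) (hf : IsSpectralDensity f)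
    (hg : IsSpectralDensity g) (h0 : 0 ≤ l) (h1 : l ≤ 1) :
    spectralMeasure (((fun ω => (1 - l) * f₀ ω) + fun ω => l * f ω) + g) =
      ENNReal.ofReal (1 - l) • spectralMeasure (f₀ + g) +
        ENNReal.ofReal l • spectralMeasure (f + g) := by
  have h2 : 0 ≤ 1 - l := by linarith
  rw [mixture_add_noise, spectralMeasure_add ((hf₀.add hg).const_mul h2)
    ((hf.add hg).const_mul h0), spectralMeasure_const_mul h2, spectralMeasure_const_mul h0]

theorem _root_.MeasureTheory.Measure.le_inv_smul_of_smul_le {α : Type*} [MeasurableSpace α]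
    {μ ν : Measure α} {c : ℝ≥0∞} (hc : c ≠ 0) (hc' : c ≠ ⊤) (h : c • μ ≤ ν) : μ ≤ c⁻¹ • ν := by
  refine Measure.le_iff.2 fun s hs => ?_
  have := Measure.le_iff.1 h s hs
  rw [Measure.smul_apply, smul_eq_mul] at this ⊢
  calc μ s = c⁻¹ * (c * μ s) := by rw [← mul_assoc, ENNReal.inv_mul_cancel hc hc', one_mul]
    _ ≤ c⁻¹ * ν s := by gcongr

theorem spectralMeasure_le_mixture (hf₀ : IsSpectralDensity f₀) (hf : IsSpectralDensity f)
    (hg : IsSpectralDensity g) (h0 : 0 < l) (h1 : l < 1) :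
    spectralMeasure (f₀ + g) ≤ (ENNReal.ofReal (1 - l))⁻¹ •
        spectralMeasure (((fun ω => (1 - l) * f₀ ω) + fun ω => l * f ω) + g) ∧
      spectralMeasure (f + g) ≤ (ENNReal.ofReal l)⁻¹ •
        spectralMeasure (((fun ω => (1 - l) * f₀ ω) + fun ω => l * f ω) + g) := by
  have hmix := spectralMeasure_mixture hf₀ hf hg h0.le h1.le
  refine ⟨Measure.le_inv_smul_of_smul_le (by simp [h1]) ENNReal.ofReal_ne_top ?_,
    Measure.le_inv_smul_of_smul_le (by simp [h0]) ENNReal.ofReal_ne_top ?_⟩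
  · rw [hmix]
    exact Measure.le_add_right le_rfl
  · rw [hmix]
    exact Measure.le_add_left le_rfl

theorem L2s_mixture_subset (hf₀ : IsSpectralDensity f₀) (hf : IsSpectralDensity f)
    (hg : IsSpectralDensity g) (h0 : 0 < l) (h1 : l < 1) :
    P.L2s (((fun ω => (1 - l) * f₀ ω) + fun ω => l * f ω) + g) ⊆
      P.L2s (f₀ + g) ∩ P.L2s (f + g) :=
  have hle := spectralMeasure_le_mixture hf₀ hf hg h0 h1
  subset_inter (P.L2s_subset_of_le (by simp [h1]) hle.1) (P.L2s_subset_of_le (by simp [h0]) hle.2)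

/-- Makes the minimizer for one mixture an admissible competitor for every other mixture. -/
theorem L2s_mixture_subset_mixture (hf₀ : IsSpectralDensity f₀) (hf : IsSpectralDensity f)
    (hg : IsSpectralDensity g) (h0 : 0 < l) (h1 : l < 1) {m : ℝ} (hm0 : 0 ≤ m) (hm1 : m ≤ 1) :
    P.L2s (((fun ω => (1 - l) * f₀ ω) + fun ω => l * f ω) + g) ⊆
      P.L2s (((fun ω => (1 - m) * f₀ ω) + fun ω => m * f ω) + g) := by
  have hle := spectralMeasure_le_mixture hf₀ hf hg h0 h1
  refine P.L2s_subset_of_le (c := ENNReal.ofReal (1 - m) * (ENNReal.ofReal (1 - l))⁻¹ +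
    ENNReal.ofReal m * (ENNReal.ofReal l)⁻¹) ?_ ?_
  · exact ENNReal.add_ne_top.2 ⟨ENNReal.mul_ne_top ENNReal.ofReal_ne_top (by simp [h1]),
      ENNReal.mul_ne_top ENNReal.ofReal_ne_top (by simp [h0])⟩
  · rw [spectralMeasure_mixture hf₀ hf hg hm0 hm1, add_smul, mul_smul, mul_smul]
    gcongr
    exacts [hle.1, hle.2]

theorem mixture_mem_l2Ball {f₁ : ℝ → ℝ} {ε : ℝ} (hf₁ : IsSpectralDensity f₁)
    (hf₀ : f₀ ∈ l2Ball f₁ ε) (hf : f ∈ l2Ball f₁ ε) (h0 : 0 ≤ l) (h1 : l ≤ 1) :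
    ((fun ω => (1 - l) * f₀ ω) + fun ω => l * f ω) ∈ l2Ball f₁ ε := by
  obtain ⟨hd₀, hi₀, hε₀⟩ := hf₀
  obtain ⟨hd, hi, hε⟩ := hf
  have h2 : 0 ≤ 1 - l := by linarith
  have hdm := (hd₀.const_mul h2).add (hd.const_mul h0)
  have hle (ω : ℝ) : |((fun ω => (1 - l) * f₀ ω) + fun ω => l * f ω) ω - f₁ ω| ^ 2 ≤
      (1 - l) * |f₀ ω - f₁ ω| ^ 2 + l * |f ω - f₁ ω| ^ 2 := by
    simp only [Pi.add_apply, sq_abs]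
    -- The two sides differ by exactly `l (1 - l) (f₀ - f)²`.
    nlinarith [mul_nonneg (mul_nonneg h0 h2) (sq_nonneg (f₀ ω - f ω))]
  have hi2 := (hi₀.const_mul (1 - l)).add (hi.const_mul l)
  have him : Integrable fun ω =>
      |((fun ω => (1 - l) * f₀ ω) + fun ω => l * f ω) ω - f₁ ω| ^ 2 := by
    refine hi2.mono' ((hdm.integrable.sub hf₁.integrable).1.norm.pow 2)
      (Eventually.of_forall fun ω => ?_)
    rw [Real.norm_of_nonneg (by positivity)]
    exact hle ω
  refine ⟨hdm, him, ?_⟩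
  have hint : ∫ ω, |((fun ω => (1 - l) * f₀ ω) + fun ω => l * f ω) ω - f₁ ω| ^ 2 ≤
      (1 - l) * (∫ ω, |f₀ ω - f₁ ω| ^ 2) + l * ∫ ω, |f ω - f₁ ω| ^ 2 := by
    rw [← integral_const_mul, ← integral_const_mul, ← integral_add (hi₀.const_mul _)
      (hi.const_mul _)]
    exact integral_mono him hi2 hle
  calc _ ≤ 1 / (2 * Real.pi) *
        ((1 - l) * (∫ ω, |f₀ ω - f₁ ω| ^ 2) + l * ∫ ω, |f ω - f₁ ω| ^ 2) := by gcongr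
    _ = (1 - l) * (1 / (2 * Real.pi) * ∫ ω, |f₀ ω - f₁ ω| ^ 2) +
        l * (1 / (2 * Real.pi) * ∫ ω, |f ω - f₁ ω| ^ 2) := by ring
    _ ≤ (1 - l) * ε + l * ε := by gcongr
    _ = ε := by ring

theorem error_ne_top (hP : P.IsAdmissible) (hf : IsSpectralDensity f) (hg : IsSpectralDensity g)
    (hh : h ∈ P.L2s (f + g)) : P.Δ h f g ≠ ⊤ := by
  rw [error_eq hP hf hg hh.1]
  exact ENNReal.ofReal_ne_top

end Mixture

end FilteringProblem

/-! ### Convergence of minimizers of mixtures -/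

/-- Sequences of values of two functionals at the minimizers of their mixtures: if the second
functional stays bounded, its values converge and control the distances of the minimizers. -/
theorem mixture_minimizers_control {l a b : ℕ → ℝ} {d : ℕ → ℕ → ℝ} (hl0 : ∀ n, 0 < l n)
    (hl1 : ∀ n, l n < 1) (hl : StrictAnti l) (hd : ∀ m n, 0 ≤ d m n)
    (H : ∀ m n, (1 - l n) * a n + l n * b n + l n * d m n ≤ (1 - l n) * a m + l n * b m)
    {m n : ℕ} (hmn : n ≤ m) : d m n ≤ b m - b n := by
  have h0n := hl0 n
  have h1n := hl1 n
  rcases hmn.eq_or_lt with rfl | hlt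
  · have := H n n
    nlinarith [hd n n]
  have hlm := hl hlt
  have h0m := hl0 m
  have h1 := H m n
  have h2 := H n m
  have hd1 := mul_nonneg h0n.le (hd m n)
  have hd2 := mul_nonneg h0m.le (hd n m)
  -- The later mixture puts more weight on `a`, so its minimizer has the smaller `a`. Weighting the
  -- two comparisons by `l m` and `l n` eliminates `b`.
  have ha : a m ≤ a n := by
    have h3 : l n * (b n - b m) ≤ (1 - l n) * (a m - a n) := by linarith
    have h4 : (1 - l m) * (a m - a n) ≤ l m * (b n - b m) := by linarith
    have h5 : l n * ((1 - l m) * (a m - a n)) ≤ l m * ((1 - l n) * (a m - a n)) :=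
      calc _ ≤ l n * (l m * (b n - b m)) := by gcongr
        _ = l m * (l n * (b n - b m)) := by ring
        _ ≤ _ := by gcongr
    have h6 : (l n - l m) * (a m - a n) ≤ 0 := by linarith
    have h7 : 0 < l n - l m := by linarith
    linarith [nonpos_of_mul_nonpos_right h6 h7]
  have h8 : (1 - l n) * a m ≤ (1 - l n) * a n :=
    mul_le_mul_of_nonneg_left ha (by linarith)
  have h9 : l n * d m n ≤ l n * (b m - b n) := by linarith
  exact le_of_mul_le_mul_left h9 h0n

/-- The sequence `b` is increasing and bounded, so `√(sup b - b N)` tends to zero and bounds all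
distances beyond `N`. -/
theorem cauchySeq_of_sq_dist_le_sub {X : Type*} [PseudoMetricSpace X] {u : ℕ → X} {b : ℕ → ℝ}
    {B : ℝ} (hB : ∀ n, b n ≤ B) (h : ∀ m n, n ≤ m → dist (u m) (u n) ^ 2 ≤ b m - b n) :
    CauchySeq u := by
  have hmono : Monotone b := fun n m hnm => by
    linarith [h m n hnm, sq_nonneg (dist (u m) (u n))]
  have hlim := tendsto_atTop_ciSup hmono ⟨B, by rintro _ ⟨n, rfl⟩; exact hB n⟩
  have hle (n : ℕ) : b n ≤ ⨆ k, b k :=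
    le_ciSup (f := b) ⟨B, by rintro _ ⟨n, rfl⟩; exact hB n⟩ n
  refine cauchySeq_of_le_tendsto_0 (fun n => √((⨆ k, b k) - b n)) ?_ ?_
  · intro n m N hn hm
    refine Real.le_sqrt_of_sq_le ?_
    rcases le_total n m with h' | h'
    · rw [dist_comm]
      linarith [h m n h', hmono hn, hle m]
    · linarith [h n m h', hmono hm, hle n]
  · have := (hlim.const_sub (⨆ k, b k)).sqrt
    simpa using this

/-- Limits in the mean with respect to two measures agree if the second measure is absolutely
continuous with respect to the first one. -/
theorem ae_eq_of_tendsto_toLp {α : Type*} [MeasurableSpace α] {μ ν : Measure α} (hνμ : ν ≪ μ)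
    {h : ℕ → α → ℂ} (hμ : ∀ n, MemLp (h n) 2 μ) (hν : ∀ n, MemLp (h n) 2 ν) {x : α → ℂ}
    (hx : MemLp x 2 μ) {y : Lp ℂ 2 ν}
    (hxlim : Tendsto (fun n => (hμ n).toLp _) atTop (𝓝 (hx.toLp x)))
    (hylim : Tendsto (fun n => (hν n).toLp _) atTop (𝓝 y)) : y =ᵐ[ν] x := by
  obtain ⟨ns, hns, hae⟩ := (tendstoInMeasure_of_tendsto_Lp hxlim).exists_seq_tendsto_ae
  -- The second subsequence is taken inside the first, so both almost everywhere limits hold along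
  -- it.
  obtain ⟨ms, hms, hae'⟩ := (tendstoInMeasure_of_tendsto_Lp
    (hylim.comp hns.tendsto_atTop)).exists_seq_tendsto_ae
  have h1 : ∀ᵐ ω ∂μ, Tendsto (fun k => h (ns k) ω) atTop (𝓝 (x ω)) := by
    filter_upwards [hae, hx.coeFn_toLp, ae_all_iff.2 fun n => (hμ n).coeFn_toLp] with ω h1 h2 h3
    simpa only [h2, h3] using h1
  filter_upwards [hνμ.ae_le h1, hae', ae_all_iff.2 fun n => (hν n).coeFn_toLp] with ω h1 h2 h3
  simp only [Function.comp_apply, h3] at h2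
  exact tendsto_nhds_unique h2 (h1.comp hms.tendsto_atTop)

/-! ### The saddle point and the minimax theorem -/

namespace FilteringProblem

variable {P : FilteringProblem} {f₁ g f₀ : ℝ → ℝ} {ε₁ : ℝ} {C₀ : ℝ → ℂ}

/-- No pair in the class has a larger optimal error than a solution of the extremal problem. -/
theorem SolvesExtremal.error_le (hP : P.IsAdmissible) (hg : IsSpectralDensity g)
    (hext : P.SolvesExtremal (l2Ball f₁ ε₁ ×ˢ {g}) f₀ g C₀) {f : ℝ → ℝ} {C : ℝ → ℂ}
    (hf : f ∈ l2Ball f₁ ε₁) (hC : P.IsSpectrumBinvRa f g C) :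
    P.Δ (P.charFormula f g C) f g ≤ P.Δ (P.charFormula f₀ g C₀) f₀ g := by
  rw [hC.error_eq_objective hP hf.1 hg, hext.2.1.error_eq_objective hP hext.1.1.1 hg]
  exact ENNReal.ofReal_le_ofReal (hext.2.2.2 ⟨(f, g), ⟨hf, rfl⟩, C, hC, rfl⟩)

/-- A solution of the extremal problem gives a saddle point of the mean-square error. -/
theorem SolvesExtremal.saddle (hP : P.IsAdmissible) (hf₁ : IsSpectralDensity f₁)
    (hg : IsSpectralDensity g) (hpos : ∀ᵐ ω, 0 < (f₀ + g) ω)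
    (hext : P.SolvesExtremal (l2Ball f₁ ε₁ ×ˢ {g}) f₀ g C₀) {f : ℝ → ℝ}
    (hf : f ∈ l2Ball f₁ ε₁) :
    P.charFormula f₀ g C₀ ∈ P.L2s (f + g) ∧
      P.Δ (P.charFormula f₀ g C₀) f g ≤ P.Δ (P.charFormula f₀ g C₀) f₀ g := by
  have hf₀ : f₀ ∈ l2Ball f₁ ε₁ := hext.1.1
  have hC₀ := hext.2.1
  set x := P.charFormula f₀ g C₀
  have hxmem : x ∈ P.L2s (f₀ + g) := hC₀.charFormula_mem_L2s hP hf₀.1 hg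
  have hfin₀ : P.Δ x f₀ g ≠ ⊤ := error_ne_top hP hf₀.1 hg hxmem
  -- The shift by `2` keeps `l n ≤ 1 / 2`, which later gives `a n ≤ 2 A₀`.
  set l : ℕ → ℝ := fun n => 1 / ((n : ℝ) + 2) with hldef
  have hl0 (n : ℕ) : 0 < l n := by positivity
  have hlhalf (n : ℕ) : l n ≤ 1 / 2 :=
    one_div_le_one_div_of_le (by norm_num) (by linarith [n.cast_nonneg (α := ℝ)])
  have hl1 (n : ℕ) : l n < 1 := by linarith [hlhalf n]
  have hlanti : StrictAnti l := fun m n hmn =>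
    one_div_lt_one_div_of_lt (by positivity) (by have : (m : ℝ) < n := by exact_mod_cast hmn
                                                 linarith)
  have hllim : Tendsto l atTop (𝓝 0) :=
    (tendsto_const_div_atTop_nhds_zero_nat (1 : ℝ)).comp (tendsto_add_atTop_nat 2) |>.congr
      fun n => by simp [hldef]
  set F : ℕ → ℝ → ℝ := fun n => (fun ω => (1 - l n) * f₀ ω) + fun ω => l n * f ω
  have hF (n : ℕ) : F n ∈ l2Ball f₁ ε₁ := mixture_mem_l2Ball hf₁ hf₀ hf (hl0 n).le (hl1 n).le
  choose C hC using fun n => exists_isSpectrumBinvRa hP (hF n).1 hg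
  set h : ℕ → ℝ → ℂ := fun n => P.charFormula (F n) g (C n)
  have hmix (n : ℕ) : h n ∈ P.L2s (F n + g) := (hC n).charFormula_mem_L2s hP (hF n).1 hg
  have hmem₀ (n : ℕ) : h n ∈ P.L2s (f₀ + g) :=
    (P.L2s_mixture_subset hf₀.1 hf.1 hg (hl0 n) (hl1 n) (hmix n)).1
  have hmem (n : ℕ) : h n ∈ P.L2s (f + g) :=
    (P.L2s_mixture_subset hf₀.1 hf.1 hg (hl0 n) (hl1 n) (hmix n)).2
  have hmem' (m n : ℕ) : h m ∈ P.L2s (F n + g) :=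
    L2s_mixture_subset_mixture hf₀.1 hf.1 hg (hl0 m) (hl1 m) (hl0 n).le (hl1 n).le (hmix m)
  set a : ℕ → ℝ := fun n => (P.Δ (h n) f₀ g).toReal
  set b : ℕ → ℝ := fun n => (P.Δ (h n) f g).toReal
  have ha (n : ℕ) : P.Δ (h n) f₀ g = ENNReal.ofReal (a n) :=
    (ENNReal.ofReal_toReal (error_ne_top hP hf₀.1 hg (hmem₀ n))).symm
  have hb (n : ℕ) : P.Δ (h n) f g = ENNReal.ofReal (b n) :=
    (ENNReal.ofReal_toReal (error_ne_top hP hf.1 hg (hmem n))).symm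
  have ha0 (n : ℕ) : 0 ≤ a n := ENNReal.toReal_nonneg
  have hb0 (n : ℕ) : 0 ≤ b n := ENNReal.toReal_nonneg
  set A₀ : ℝ := (P.Δ x f₀ g).toReal
  have hA₀ : P.Δ x f₀ g = ENNReal.ofReal A₀ := (ENNReal.ofReal_toReal hfin₀).symm
  have hA0 : 0 ≤ A₀ := ENNReal.toReal_nonneg
  set v : ℕ → Lp ℂ 2 (spectralMeasure (f₀ + g)) := fun n => (hmem₀ n).1.toLp _
  set u : ℕ → Lp ℂ 2 (spectralMeasure (f + g)) := fun n => (hmem n).1.toLp _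
  have hFerr (m n : ℕ) :
      P.Δ (h m) (F n) g = ENNReal.ofReal ((1 - l n) * a m + l n * b m) := by
    have h2 : 0 ≤ 1 - l n := by linarith [hl1 n]
    rw [error_mixture hf₀.1 hf.1 (hl0 n).le (hl1 n).le, ha, hb, ← ENNReal.ofReal_mul h2,
      ← ENNReal.ofReal_mul (hl0 n).le, ← ENNReal.ofReal_add (mul_nonneg h2 (ha0 m))
      (mul_nonneg (hl0 n).le (hb0 m))]
  have hdist (m n : ℕ) : ∫⁻ ω, ‖h m ω - h n ω‖ₑ ^ 2 ∂spectralMeasure (f + g) =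
      ENNReal.ofReal (dist (u m) (u n) ^ 2) := by
    rw [dist_eq_norm]
    exact norm_toLp_sq ((hmem m).1.sub (hmem n).1)
  -- Pythagoras for the `n`-th mixture. Of the squared distance only the share `l n` of `f + g` is
  -- kept.
  have hkey (m n : ℕ) : (1 - l n) * a n + l n * b n + l n * dist (u m) (u n) ^ 2 ≤
      (1 - l n) * a m + l n * b m := by
    have h2 : 0 ≤ 1 - l n := by linarith [hl1 n]
    have h3 := (hC n).error_eq_add hP (hF n).1 hg (hmem' m n)
    rw [hFerr m n, hFerr n n, spectralMeasure_mixture hf₀.1 hf.1 hg (hl0 n).le (hl1 n).le,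
      lintegral_add_measure, lintegral_smul_measure, lintegral_smul_measure, hdist m n,
      smul_eq_mul, smul_eq_mul, ← ENNReal.ofReal_mul (hl0 n).le] at h3
    have hnn : 0 ≤ (1 - l n) * a n + l n * b n :=
      add_nonneg (mul_nonneg h2 (ha0 n)) (mul_nonneg (hl0 n).le (hb0 n))
    refine (ENNReal.ofReal_le_ofReal_iff (add_nonneg (mul_nonneg h2 (ha0 m))
      (mul_nonneg (hl0 n).le (hb0 m)))).1 ?_
    rw [h3, ENNReal.ofReal_add hnn (mul_nonneg (hl0 n).le (sq_nonneg _))]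
    gcongr
    exact le_add_self
  have hmax (n : ℕ) : (1 - l n) * a n + l n * b n ≤ A₀ := by
    have := hext.error_le hP hg (hF n) (hC n)
    rw [hFerr n n, hA₀] at this
    exact (ENNReal.ofReal_le_ofReal_iff hA0).1 this
  have hv (n : ℕ) : a n = A₀ + dist (v n) (hxmem.1.toLp x) ^ 2 := by
    have h3 := hC₀.error_eq_add hP hf₀.1 hg (hmem₀ n)
    have h4 : ∫⁻ ω, ‖h n ω - x ω‖ₑ ^ 2 ∂spectralMeasure (f₀ + g) =
        ENNReal.ofReal (dist (v n) (hxmem.1.toLp x) ^ 2) := by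
      rw [dist_eq_norm]
      exact norm_toLp_sq ((hmem₀ n).1.sub hxmem.1)
    rw [ha, h4, hA₀, ← ENNReal.ofReal_add hA0 (sq_nonneg _)] at h3
    exact (ENNReal.ofReal_eq_ofReal_iff (ha0 n) (by positivity)).1 h3
  -- The mean of `a n` and `b n` is at most `A₀`, while `a n ≥ A₀` because `x` is optimal for `f₀`.
  have hbA (n : ℕ) : b n ≤ A₀ := by
    have h1 : (1 - l n) * A₀ ≤ (1 - l n) * a n :=
      mul_le_mul_of_nonneg_left (by linarith [hv n, sq_nonneg (dist (v n) (hxmem.1.toLp x))])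
        (by linarith [hl1 n])
    refine le_of_mul_le_mul_left ?_ (hl0 n)
    linarith [hmax n]
  have hvlim : Tendsto v atTop (𝓝 (hxmem.1.toLp x)) := by
    -- The squared distance is `a n - A₀ ≤ l n * (a n - b n)`, with `b n ≥ 0` and `a n ≤ 2 A₀`.
    have h1 (n : ℕ) : dist (v n) (hxmem.1.toLp x) ^ 2 ≤ l n * (2 * A₀) := by
      have h2 := hmax n
      have h3 := mul_nonneg (hl0 n).le (hb0 n)
      have h4 : (1 / 2) * a n ≤ (1 - l n) * a n :=
        mul_le_mul_of_nonneg_right (by linarith [hlhalf n]) (ha0 n)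
      have h5 : l n * a n ≤ l n * (2 * A₀) :=
        mul_le_mul_of_nonneg_left (by linarith) (hl0 n).le
      linarith [hv n]
    refine tendsto_iff_dist_tendsto_zero.2 (squeeze_zero (fun _ => dist_nonneg)
      (fun n => Real.le_sqrt_of_sq_le (h1 n)) ?_)
    simpa using (hllim.mul_const (2 * A₀)).sqrt
  obtain ⟨y, hy⟩ := cauchySeq_tendsto_of_complete (cauchySeq_of_sq_dist_le_sub hbA
    fun m n hmn => mixture_minimizers_control (d := fun m n => dist (u m) (u n) ^ 2) hl0 hl1
      hlanti (fun _ _ => sq_nonneg _) hkey hmn)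
  -- As `f₀ + g > 0` almost everywhere, null sets of its spectral measure are Lebesgue null.
  have hac : spectralMeasure (f + g) ≪ spectralMeasure (f₀ + g) := by
    intro s hs
    refine spectralMeasure_absolutelyContinuous _ ?_
    have := ae_of_ae_spectralMeasure (hf₀.1.add hg) hpos (measure_eq_zero_iff_ae_notMem.1 hs)
    exact measure_eq_zero_iff_ae_notMem.2 this
  have hyx : y =ᵐ[spectralMeasure (f + g)] x :=
    ae_eq_of_tendsto_toLp hac (fun n => (hmem₀ n).1) (fun n => (hmem n).1) hxmem.1 hvlim hy
  have hxm : MemLp x 2 (spectralMeasure (f + g)) := (memLp_congr_ae hyx).1 (Lp.memLp y)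
  obtain rfl : hxm.toLp x = y := Lp.ext (hxm.coeFn_toLp.trans hyx.symm)
  refine ⟨(P.mem_L2s_iff (hf.1.add hg)).2 ⟨hxm, ?_⟩, ?_⟩
  · refine (Submodule.isClosed_topologicalClosure _).mem_of_tendsto hy
      (Eventually.of_forall fun n => ?_)
    exact ((P.mem_L2s_iff (hf.1.add hg)).1 (hmem n)).2
  · rw [error_eq hP hf.1 hg hxm]
    refine le_of_tendsto (ENNReal.tendsto_ofReal (((hy.sub_const _).norm.pow 2).add_const
      (P.noiseTerm f g))) (Eventually.of_forall fun n => ?_)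
    rw [← error_eq hP hf.1 hg (hmem n).1, hb, hA₀]
    exact ENNReal.ofReal_le_ofReal (hbA n)

end FilteringProblem

theorem mainTheorem8 (P : FilteringProblem) (hP : P.IsAdmissible)
    (f₁ g f₀ : ℝ → ℝ) (ε₁ α₁ : ℝ) (C₀ : ℝ → ℂ)
    (hf₁ : IsSpectralDensity f₁) (hg : IsSpectralDensity g)
    (hf₀ : f₀ ∈ l2Ball f₁ ε₁)
    (hmin : MinimalityCondition (f₀ + g))
    (hC₀ : P.IsSpectrumBinvRa f₀ g C₀)
    (hbdd : ∃ b : ℝ, ∀ᵐ ω : ℝ, ‖P.A ω * g ω + C₀ ω‖ ^ 2 / (f₀ ω + g ω) ^ 2 ≤ b)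
    (hrel : ∀ᵐ ω : ℝ, ‖P.A ω * g ω + C₀ ω‖ ^ 2 = (f₀ ω + g ω) ^ 2 * (f₀ ω - f₁ ω) * α₁)
    (hext : P.SolvesExtremal (l2Ball f₁ ε₁ ×ˢ {g}) f₀ g C₀) :
    P.IsLeastFavorable (l2Ball f₁ ε₁ ×ˢ {g}) f₀ g ∧
      P.IsOptimal f₀ g (P.charFormula f₀ g C₀) ∧
      P.IsMinimaxRobust (l2Ball f₁ ε₁ ×ˢ {g}) (P.charFormula f₀ g C₀) ∧
      ∀ h, P.IsMinimaxRobust (l2Ball f₁ ε₁ ×ˢ {g}) h →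
        h =ᵐ[volume] P.charFormula f₀ g C₀ := by
  have hpos := ae_pos_of_minimalityCondition (hf₀.1.add hg) hmin
  have hopt := hC₀.isOptimal hP hf₀.1 hg
  have hsaddle : ∀ p ∈ l2Ball f₁ ε₁ ×ˢ {g}, P.charFormula f₀ g C₀ ∈ P.L2s (p.1 + p.2) ∧
      P.Δ (P.charFormula f₀ g C₀) p.1 p.2 ≤ P.Δ (P.charFormula f₀ g C₀) f₀ g := by
    rintro ⟨f, g'⟩ ⟨hf, rfl⟩
    exact hext.saddle hP hf₁ hg hpos hf
  have hD : (f₀, g) ∈ l2Ball f₁ ε₁ ×ˢ {g} := hext.1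
  have hHD : P.charFormula f₀ g C₀ ∈ P.HD (l2Ball f₁ ε₁ ×ˢ {g}) :=
    mem_iInter₂.2 fun p hp => (hsaddle p hp).1
  have hsup : ⨆ p ∈ l2Ball f₁ ε₁ ×ˢ {g}, P.Δ (P.charFormula f₀ g C₀) p.1 p.2 ≤
      P.Δ (P.charFormula f₀ g C₀) f₀ g := iSup₂_le fun p hp => (hsaddle p hp).2
  have hle_sup (h : ℝ → ℂ) : P.Δ h f₀ g ≤ ⨆ p ∈ l2Ball f₁ ε₁ ×ˢ {g}, P.Δ h p.1 p.2 :=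
    le_iSup₂ (f := fun (p : (ℝ → ℝ) × (ℝ → ℝ)) (_ : p ∈ l2Ball f₁ ε₁ ×ˢ {g}) =>
      P.Δ h p.1 p.2) (f₀, g) hD
  refine ⟨⟨hD, _, hopt, ?_⟩, hopt, ⟨hHD, ⟨(f₀, g), hD, fun q hq => (hsaddle q hq).2⟩, ?_⟩, ?_⟩
  · intro p hp h hh
    exact (hh.2 _ (hsaddle p hp).1).trans (hsaddle p hp).2
  · intro h hh
    exact hsup.trans ((hopt.2 h (mem_iInter₂.1 hh (f₀, g) hD)).trans (hle_sup h))
  · intro h hh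
    have hmem : h ∈ P.L2s (f₀ + g) := mem_iInter₂.1 hh.1 (f₀, g) hD
    have hle : P.Δ h f₀ g ≤ P.Δ (P.charFormula f₀ g C₀) f₀ g :=
      (hle_sup h).trans ((hh.2.2 _ hHD).trans hsup)
    have hfin := FilteringProblem.error_ne_top hP hf₀.1 hg hopt.1
    rw [hC₀.error_eq_add hP hf₀.1 hg hmem] at hle
    -- A robust `h` does no worse at `f₀` than the optimum, so the Pythagorean excess vanishes.
    -- Cancelling the optimal error requires it to be finite.
    have hzero : ∫⁻ ω, ‖h ω - P.charFormula f₀ g C₀ ω‖ₑ ^ 2 ∂spectralMeasure (f₀ + g) = 0 := by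
      refine le_antisymm ?_ zero_le
      rw [← ENNReal.add_le_add_iff_left hfin, add_zero]
      exact hle
    have hae := (lintegral_eq_zero_iff' ((hmem.1.1.sub hopt.1.1.1).enorm.pow_const 2)).1 hzero
    filter_upwards [ae_of_ae_spectralMeasure (hf₀.1.add hg) hpos hae] with ω hω
    simpa [sub_eq_zero] using hω
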